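/- A hypergraph $H=(V,E)$ consists of a finite non-empty vertex set $V$ and a finite multiset $E$ of non-empty subsets of $V$ (the edges). A closed trail in $H$ is a sequence $v_0e_1v_1\cdots e_kv_k$ with $k\ge 2$, $v_k=v_0$, pairwise distinct edges $e_1,\dots,e_k$ of $H$ (distinct copies of the same set count as distinct edges), and $v_{i-1}\ne v_i$, $v_{i-1},v_i\in e_i$ for all $i$; its anchors are $v_0,\dots,v_k$. A spanning Euler family of $H$ is a set of pairwise edge-disjoint and pairwise anchor-disjoint closed trails of $H$ that jointly traverse every edge of $H$ and such that every vertex of $H$ is an anchor of exactly one of them. For $S\subseteq V$, $H\backslash S$ denotes the hypergraph with vertex set $V-S$ whose edges are the non-empty sets among $e-S$, $e\in E$ (with multiplicity). A 2-vertex cut of $H$ is a set $S\subsetneq V$ with $|S|=2$ such that $H\backslash S$ is disconnected. **Theorem.** Let $H=(V,E)$ be a hypergraph with a 2-vertex cut $S=\{u,v\}$, and assume that the number of edges of $H$ equal to $S$ (counted with multiplicity) is odd. Let $H_1,\dots,H_k$ be the connected components of $H\backslash S$. For each $i$, let $H_i'$ be the hypergraph with vertex set $V(H_i)\cup S$ whose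 edges are all the edges of $H$ contained in $V(H_i)\cup S$, and let $H_i^\ast$ be obtained from $H_i'$ by adjoining one further copy of the edge $S$. Then $H$ admits a spanning Euler family if and only if there exists a subset $J\subseteq\{1,\dots,k\}$ of odd size such that 1. $H_i'$ admits a spanning Euler family for each $i\in J$; and 2. for each $i\notin J$, at least one of $H_i$ and $H_i^\ast$ admits a spanning Euler family. -/

import Mathlib

/-- A hypergraph with vertex type `V` whose edges form a multiset of subsets of `V`.
The multiset is presented as a family indexed by `E`: distinct indices with the same vertex
set are distinct copies of the same edge. (Finiteness of `V` and `E` is imposed by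
instance arguments where it is needed.) -/
structure MultiHypergraph (V : Type*) (E : Type*) where
  /-- The set of vertices of an edge. -/
  ends : E → Set V

namespace MultiHypergraph

universe u v

variable {V : Type u} {E : Type v}

/-- `x` and `y` are adjacent via the edge `e`; adjacent vertices are distinct. -/
def AdjVia (H : MultiHypergraph V E) (e : E) (x y : V) : Prop :=
  x ≠ y ∧ x ∈ H.ends e ∧ y ∈ H.ends e

/-- An `(x, y)`-walk: an alternating sequence of vertices and edges, consecutive vertices being
adjacent via the edge between them. -/
inductive Walk (H : MultiHypergraph V E) : V → V → Type (max u v)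
  | nil (x : V) : Walk H x x
  | cons {x y z : V} (e : E) (h : H.AdjVia e x y) (p : Walk H y z) : Walk H x z

namespace Walk

variable {H : MultiHypergraph V E}

/-- The sequence `v₀, v₁, …, vₖ` of anchors of a walk. -/
def anchorList {x y : V} : H.Walk x y → List V
  | nil x => [x]
  | @cons _ _ _ x _ _ _ _ p => x :: p.anchorList

/-- The sequence `e₁, …, eₖ` of edges of a walk. -/
def edgeList {x y : V} : H.Walk x y → List E
  | nil _ => []
  | cons e _ p => e :: p.edgeList

/-- The length `k` of a walk. -/
def length {x y : V} (p : H.Walk x y) : ℕ := p.edgeList.length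

end Walk

/-- A closed trail: a walk of length at least `2` that returns to its first vertex and has
pairwise distinct edges. -/
structure ClosedTrail (H : MultiHypergraph V E) where
  /-- The common first and last vertex. -/
  base : V
  /-- The underlying walk. -/
  walk : H.Walk base base
  two_le_length : 2 ≤ walk.length
  nodup : walk.edgeList.Nodup

/-- The set of anchors of a closed trail. -/
def ClosedTrail.anchors {H : MultiHypergraph V E} (T : H.ClosedTrail) : Set V :=
  {x | x ∈ T.walk.anchorList}

/-- The set of edges traversed by a closed trail. -/
def ClosedTrail.edges {H : MultiHypergraph V E} (T : H.ClosedTrail) : Set E :=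
  {e | e ∈ T.walk.edgeList}

/-- An Euler family: a set of pairwise edge-disjoint and anchor-disjoint closed trails jointly
traversing every edge. -/
def IsEulerFamily (H : MultiHypergraph V E) (F : Set H.ClosedTrail) : Prop :=
  (F.Pairwise fun T T' => Disjoint T.edges T'.edges ∧ Disjoint T.anchors T'.anchors) ∧
    ∀ e : E, ∃ T ∈ F, e ∈ T.edges

/-- A spanning Euler family: an Euler family such that every vertex is an anchor of exactly one
of its trails. -/
def IsSpanningEulerFamily (H : MultiHypergraph V E) (F : Set H.ClosedTrail) : Prop :=
  H.IsEulerFamily F ∧ ∀ x : V, ∃! T : H.ClosedTrail, T ∈ F ∧ x ∈ T.anchors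

/-- `H` admits a spanning Euler family. -/
def HasSpanningEulerFamily (H : MultiHypergraph V E) : Prop :=
  ∃ F : Set H.ClosedTrail, H.IsSpanningEulerFamily F

/-- The subhypergraph induced by a set `W` of vertices: every edge is intersected with `W`, and
empty intersections are dropped. -/
def induce (H : MultiHypergraph V E) (W : Set V) :
    MultiHypergraph W {e : E // (H.ends e ∩ W).Nonempty} where
  ends e := {x : W | x.1 ∈ H.ends e.1}

/-- `H \ S`, the subhypergraph induced by the complement of `S`. -/
def deleteVerts (H : MultiHypergraph V E) (S : Set V) :
    MultiHypergraph (Sᶜ : Set V) {e : E // (H.ends e ∩ Sᶜ).Nonempty} :=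
  H.induce Sᶜ

/-- Two vertices are connected if some walk joins them. -/
def Reachable (H : MultiHypergraph V E) (x y : V) : Prop := Nonempty (H.Walk x y)

/-- Every two vertices are connected. -/
def Connected (H : MultiHypergraph V E) : Prop := ∀ x y : V, H.Reachable x y

theorem Reachable.trans {H : MultiHypergraph V E} {x y z : V} (h₁ : H.Reachable x y)
    (h₂ : H.Reachable y z) : H.Reachable x z := by
  obtain ⟨p⟩ := h₁
  induction p with
  | nil _ => exact h₂
  | cons e h _ ih => exact (ih h₂).elim fun q => ⟨.cons e h q⟩

theorem Reachable.symm {H : MultiHypergraph V E} {x y : V} (h : H.Reachable x y) :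
    H.Reachable y x := by
  obtain ⟨p⟩ := h
  induction p with
  | nil x => exact ⟨.nil x⟩
  | cons e h _ ih => exact ih.trans ⟨.cons e ⟨h.1.symm, h.2.2, h.2.1⟩ (.nil _)⟩

/-- The equivalence relation of being connected by a walk. -/
def reachableSetoid (H : MultiHypergraph V E) : Setoid V where
  r := H.Reachable
  iseqv := ⟨fun x => ⟨.nil x⟩, Reachable.symm, Reachable.trans⟩

/-- The index set of the connected components: the classes of mutually connected vertices. -/
def Component (H : MultiHypergraph V E) : Type u := Quotient H.reachableSetoid

/-- The vertex set of a connected component. -/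
def Component.verts {H : MultiHypergraph V E} (c : H.Component) : Set V :=
  {x | Quotient.mk H.reachableSetoid x = c}

/-- The connected component itself, as a hypergraph: the maximal connected subhypergraph without
empty edges on the vertex class `c`. It has all the nonempty edges that meet the class (and such
an edge lies inside the class). -/
def componentGraph (H : MultiHypergraph V E) (c : H.Component) :
    MultiHypergraph c.verts {e : E // (H.ends e ∩ c.verts).Nonempty} :=
  H.induce c.verts

/-- A vertex cut: a proper subset `S` of the vertex set such that `H \ S` is disconnected. -/
def IsVertexCut (H : MultiHypergraph V E) (S : Set V) : Prop :=
  S ≠ Set.univ ∧ ¬ (H.deleteVerts S).Connected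

/-- A vertex cut of cardinality `k`. -/
def IsKVertexCut (H : MultiHypergraph V E) (k : ℕ) (S : Set V) : Prop :=
  H.IsVertexCut S ∧ S.Finite ∧ S.ncard = k

/-- The vertex set `V(F) ∪ S` of the `S`-component corresponding to a connected component `F` of
`H \ S`. -/
def sVerts (H : MultiHypergraph V E) (S : Set V) (c : (H.deleteVerts S).Component) : Set V :=
  Subtype.val '' c.verts ∪ S

/-- The `S`-component corresponding to a connected component `F` of `H \ S`: its vertex set is
`V(F) ∪ S`, its edges are the nonempty edges of `H` contained in `V(F) ∪ S`. -/
def sComponent (H : MultiHypergraph V E) (S : Set V) (c : (H.deleteVerts S).Component) :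
    MultiHypergraph (H.sVerts S c) {e : E // H.ends e ⊆ H.sVerts S c ∧ H.ends e ≠ ∅} where
  ends e := {x : H.sVerts S c | x.1 ∈ H.ends e.1}

/-- The hypergraph obtained by adjoining `n` copies of the edge `A`. -/
def adjoin (H : MultiHypergraph V E) (A : Set V) (n : ℕ) : MultiHypergraph V (E ⊕ Fin n) where
  ends := Sum.elim H.ends fun _ => A

/-- The `S*`-component corresponding to a connected component of `H \ S` (meaningful for `|S|`
even): the `S`-component with `|S| / 2` additional copies of the edge `S`. -/
noncomputable def sStarComponent (H : MultiHypergraph V E) (S : Set V)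
    (c : (H.deleteVerts S).Component) :
    MultiHypergraph (H.sVerts S c)
      ({e : E // H.ends e ⊆ H.sVerts S c ∧ H.ends e ≠ ∅} ⊕ Fin (S.ncard / 2)) :=
  (H.sComponent S c).adjoin {x : H.sVerts S c | x.1 ∈ S} (S.ncard / 2)

end MultiHypergraph

/-! Choosing the two consecutive anchors at which each edge is traversed turns a spanning Euler
family into a multigraph on `V` in which every degree is positive and even. Conversely, Euler's
theorem splits any such multigraph into closed trails. So the question is whether two vertices can
be selected from every edge with all degrees positive and even (`hasSpanningEulerFamily_iff`).

An edge not contained in `S` meets exactly one component of `H \ S`. A copy of `S` has only one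
possible selection, and a one-vertex edge inside `S` has none. A selection for `H` is therefore a
family of independent selections, one per component, coupled only by the parities at `u` and `v`.
Since the number of copies of `S` is odd, the component degrees must sum to an odd number at `u` and
at `v`; positivity there is automatic.

By the handshake lemma (`IsEvenSelection.even_add`) each component has equal parities at `u` and
`v`. Odd parity is what `sComponent` requires, where an odd number of copies of `S` is added. Even
parity is what `sStarComponent` requires, with one more copy, and `componentGraph` gives degree zero
at both. Hence `J` is the set of components of odd parity. -/

namespace MultiHypergraph

universe u v

variable {V : Type u} {E : Type v}

/-! ### Walks and the vertex pairs they select from edges -/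

namespace Walk

variable {H : MultiHypergraph V E}

theorem left_mem_anchorList {x y : V} (p : H.Walk x y) : x ∈ p.anchorList := by
  cases p <;> simp [anchorList]

/-- The concatenation of two walks. -/
def append {x y z : V} : H.Walk x y → H.Walk y z → H.Walk x z
  | nil _, q => q
  | cons e h p, q => cons e h (p.append q)

theorem edgeList_append {x y z : V} (p : H.Walk x y) (q : H.Walk y z) :
    (p.append q).edgeList = p.edgeList ++ q.edgeList := by
  induction p with
  | nil x => rfl
  | cons e h p ih => simp [append, edgeList, ih]

theorem exists_split {x y z : V} (p : H.Walk x y) (hz : z ∈ p.anchorList) :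
    ∃ (q : H.Walk x z) (r : H.Walk z y), p.edgeList = q.edgeList ++ r.edgeList := by
  induction p with
  | nil x =>
    obtain rfl : z = x := by simpa [anchorList] using hz
    exact ⟨nil z, nil z, rfl⟩
  | @cons a b c e h p ih =>
    rcases eq_or_ne z a with rfl | hne
    · exact ⟨nil z, cons e h p, rfl⟩
    · obtain ⟨q, r, hqr⟩ := ih (by simpa [anchorList, hne] using hz)
      exact ⟨cons e h q, r, by simp [edgeList, hqr]⟩

/-- The vertices between which a walk traverses an edge (empty for an untraversed edge). -/
def stepEnds {x y : V} : H.Walk x y → E → Set V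
  | nil _ => fun _ => ∅
  | @cons _ _ _ x y _ e' _ p => fun e => {z | e = e' ∧ (z = x ∨ z = y)} ∪ p.stepEnds e

theorem stepEnds_eq_empty {x y : V} (p : H.Walk x y) {e : E} (he : e ∉ p.edgeList) :
    p.stepEnds e = ∅ := by
  induction p with
  | nil x => rfl
  | cons e' h p ih =>
    simp only [edgeList, List.mem_cons, not_or] at he
    simp [stepEnds, ih he.2, he.1]

theorem stepEnds_of_nodup {x y : V} (p : H.Walk x y) (hp : p.edgeList.Nodup) {e : E}
    (he : e ∈ p.edgeList) : p.stepEnds e ⊆ H.ends e ∧ (p.stepEnds e).ncard = 2 := by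
  induction p with
  | nil x => simp [edgeList] at he
  | @cons a b c e' h p ih =>
    simp only [edgeList, List.nodup_cons, List.mem_cons] at hp he
    by_cases hee : e = e'
    · subst hee
      have h2 : (cons e h p).stepEnds e = {a, b} := by
        ext z
        simp [stepEnds, stepEnds_eq_empty p hp.1]
      rw [h2]
      refine ⟨?_, Set.ncard_pair h.1⟩
      rintro z (rfl | rfl)
      exacts [h.2.1, h.2.2]
    · have h2 : (cons e' h p).stepEnds e = p.stepEnds e := by
        simp [stepEnds, hee]
      rw [h2]
      exact ih hp.2 (he.resolve_left hee)

theorem mem_anchorList_of_mem_stepEnds {x y z : V} (p : H.Walk x y) {e : E}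
    (hz : z ∈ p.stepEnds e) : z ∈ p.anchorList := by
  induction p with
  | nil x => simp [stepEnds] at hz
  | cons e' h p ih =>
    rcases hz with ⟨-, rfl | rfl⟩ | hz
    · simp [anchorList]
    · simp [anchorList, left_mem_anchorList]
    · simp [anchorList, ih hz]

theorem exists_mem_stepEnds {x y z : V} (p : H.Walk x y) (hp : p.edgeList ≠ [])
    (hz : z ∈ p.anchorList) : ∃ e ∈ p.edgeList, z ∈ p.stepEnds e := by
  induction p with
  | nil x => simp [edgeList] at hp
  | @cons a b c e h p ih =>
    by_cases hza : z = a
    · exact ⟨e, by simp [edgeList], Or.inl ⟨rfl, Or.inl hza⟩⟩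
    by_cases hzb : z = b
    · exact ⟨e, by simp [edgeList], Or.inl ⟨rfl, Or.inr hzb⟩⟩
    have hz' : z ∈ p.anchorList := by simpa [anchorList, hza] using hz
    have hne : p.edgeList ≠ [] := by
      cases p with
      | nil => simp [anchorList, hzb] at hz'
      | cons => simp [edgeList]
    obtain ⟨f, hf, hzf⟩ := ih hne hz'
    exact ⟨f, by simp [edgeList, hf], Or.inr hzf⟩

/-- Prepending a step along a new edge changes the parity at exactly the two ends of that step. -/
theorem even_ncard_stepEnds [Finite E] {x y : V} (p : H.Walk x y) (hp : p.edgeList.Nodup)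
    (z : V) : Even {e | z ∈ p.stepEnds e}.ncard ↔ (z = x ↔ z = y) := by
  induction p with
  | nil x => simp [stepEnds]
  | @cons a b c e h p ih =>
    simp only [edgeList, List.nodup_cons] at hp
    specialize ih hp.2
    have hab : a ≠ b := h.1
    by_cases hz : z = a ∨ z = b
    · have h2 : {f | z ∈ (cons e h p).stepEnds f} = insert e {f | z ∈ p.stepEnds f} := by
        ext f
        simp [stepEnds, hz]
      rw [h2, Set.ncard_insert_of_notMem (by simp [stepEnds_eq_empty p hp.1]), Nat.even_add_one,
        ih]
      rcases hz with rfl | rfl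
      · simp [hab]
      · simp [hab.symm]
    · have h2 : {f | z ∈ (cons e h p).stepEnds f} = {f | z ∈ p.stepEnds f} := by
        ext f
        simp [stepEnds, hz]
      rw [not_or] at hz
      rw [h2, ih]
      simp [hz.1, hz.2]

theorem two_le_length {x : V} (p : H.Walk x x) (hp : p.edgeList ≠ []) : 2 ≤ p.length := by
  cases p with
  | nil => simp [edgeList] at hp
  | cons e h p =>
    cases p with
    | nil => exact absurd rfl h.1
    | cons => simp [length, edgeList]

/-- A walk in `G` is a walk in every hypergraph with larger edges. -/
def mapLe {G : MultiHypergraph V E} (hle : ∀ e, G.ends e ⊆ H.ends e) {x y : V} :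
    G.Walk x y → H.Walk x y
  | nil x => nil x
  | cons e h p => cons e ⟨h.1, hle e h.2.1, hle e h.2.2⟩ (p.mapLe hle)

theorem edgeList_mapLe {G : MultiHypergraph V E} (hle : ∀ e, G.ends e ⊆ H.ends e) {x y : V}
    (p : G.Walk x y) : (p.mapLe hle).edgeList = p.edgeList := by
  induction p with
  | nil x => rfl
  | cons e h p ih => simp [mapLe, edgeList, ih]

theorem anchorList_mapLe {G : MultiHypergraph V E} (hle : ∀ e, G.ends e ⊆ H.ends e) {x y : V}
    (p : G.Walk x y) : (p.mapLe hle).anchorList = p.anchorList := by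
  induction p with
  | nil x => rfl
  | cons e h p ih => simp [mapLe, anchorList, ih]

end Walk

theorem ClosedTrail.edgeList_ne_nil {H : MultiHypergraph V E} (T : H.ClosedTrail) :
    T.walk.edgeList ≠ [] := by
  have := T.two_le_length
  intro h
  simp [Walk.length, h] at this

/-- A closed trail in `G` is a closed trail in every hypergraph with larger edges. -/
def ClosedTrail.mapLe {G H : MultiHypergraph V E} (hle : ∀ e, G.ends e ⊆ H.ends e)
    (T : G.ClosedTrail) : H.ClosedTrail where
  base := T.base
  walk := T.walk.mapLe hle
  two_le_length := by
    have := T.two_le_length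
    rwa [Walk.length, Walk.edgeList_mapLe]
  nodup := by
    rw [Walk.edgeList_mapLe]
    exact T.nodup

theorem ClosedTrail.edges_mapLe {G H : MultiHypergraph V E} (hle : ∀ e, G.ends e ⊆ H.ends e)
    (T : G.ClosedTrail) : (T.mapLe hle).edges = T.edges := by
  simp [edges, mapLe, Walk.edgeList_mapLe]

theorem ClosedTrail.anchors_mapLe {G H : MultiHypergraph V E} (hle : ∀ e, G.ends e ⊆ H.ends e)
    (T : G.ClosedTrail) : (T.mapLe hle).anchors = T.anchors := by
  simp [anchors, mapLe, Walk.anchorList_mapLe]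

/-! ### Euler's theorem for multigraphs -/

section Multigraph

variable {G : MultiHypergraph V E}

theorem ends_finite_of_ncard (hG : ∀ e, (G.ends e).ncard = 2) (e : E) : (G.ends e).Finite :=
  Set.finite_of_ncard_ne_zero (by rw [hG e]; decide)

theorem stepEnds_eq_ends (hG : ∀ e, (G.ends e).ncard = 2) {x y : V} (p : G.Walk x y)
    (hp : p.edgeList.Nodup) {e : E} (he : e ∈ p.edgeList) : p.stepEnds e = G.ends e := by
  obtain ⟨h1, h2⟩ := p.stepEnds_of_nodup hp he
  exact Set.eq_of_subset_of_ncard_le h1 (by rw [h2, hG e]) (ends_finite_of_ncard hG e)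

theorem setOf_mem_stepEnds (hG : ∀ e, (G.ends e).ncard = 2) {x y : V} (p : G.Walk x y)
    (hp : p.edgeList.Nodup) (z : V) :
    {e | z ∈ p.stepEnds e} = {e | e ∈ p.edgeList ∧ z ∈ G.ends e} := by
  ext e
  by_cases he : e ∈ p.edgeList
  · simp [he, stepEnds_eq_ends hG p hp he]
  · simp [he, p.stepEnds_eq_empty he]

/-- Every vertex has even degree with respect to the edges in `A`. -/
def EvenOn (G : MultiHypergraph V E) (A : Set E) : Prop :=
  ∀ x, Even {e | e ∈ A ∧ x ∈ G.ends e}.ncard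

/-- A trail whose edges lie in `A`. -/
def Walk.IsTrailIn {x y : V} (p : G.Walk x y) (A : Set E) : Prop :=
  p.edgeList.Nodup ∧ ∀ e ∈ p.edgeList, e ∈ A

theorem length_le_of_isTrailIn [Finite E] {A : Set E} {x y : V} (p : G.Walk x y)
    (hp : p.IsTrailIn A) : p.edgeList.length ≤ A.ncard := by
  classical
  rw [← List.toFinset_card_of_nodup hp.1, ← Set.ncard_coe_finset]
  exact Set.ncard_le_ncard (fun e he => hp.2 e (by simpa using he)) (Set.toFinite A)

/-- At a start `y ≠ x` the trail uses an odd number of edges while `A` has an even number, so an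
unused edge extends it backwards. The number `n` bounds how many extensions remain possible. -/
theorem exists_closed_of_trail [Finite E] (hG : ∀ e, (G.ends e).ncard = 2) {A : Set E}
    (hA : G.EvenOn A) {x : V} (n : ℕ) : ∀ {y : V} (p : G.Walk y x), p.edgeList ≠ [] →
    p.IsTrailIn A → A.ncard ≤ p.edgeList.length + n →
    ∃ q : G.Walk x x, q.edgeList ≠ [] ∧ q.IsTrailIn A := by
  classical
  have key : ∀ {y : V} (p : G.Walk y x), p.IsTrailIn A → y ≠ x →
      ∃ (w : V) (q : G.Walk w x), q.IsTrailIn A ∧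
        q.edgeList.length = p.edgeList.length + 1 := by
    intro y p hp hyx
    have hpar := p.even_ncard_stepEnds hp.1 y
    rw [setOf_mem_stepEnds hG p hp.1] at hpar
    have hex : ∃ e, e ∈ A ∧ y ∈ G.ends e ∧ e ∉ p.edgeList := by
      by_contra! hcon
      have : {e | e ∈ p.edgeList ∧ y ∈ G.ends e} = {e | e ∈ A ∧ y ∈ G.ends e} := by
        ext e
        exact ⟨fun h => ⟨hp.2 e h.1, h.2⟩, fun h => ⟨hcon e h.1 h.2, h.2⟩⟩
      rw [this] at hpar
      simpa [hyx] using hpar.1 (hA y)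
    obtain ⟨e, heA, hye, hep⟩ := hex
    obtain ⟨w, hw, hwy⟩ := Set.exists_ne_of_one_lt_ncard (s := G.ends e) (by rw [hG e]; decide) y
    refine ⟨w, .cons e ⟨hwy, hw, hye⟩ p, ⟨?_, ?_⟩, rfl⟩
    · exact List.nodup_cons.2 ⟨hep, hp.1⟩
    · simp only [Walk.edgeList, List.mem_cons]
      rintro f (rfl | hf)
      exacts [heA, hp.2 f hf]
  induction n with
  | zero =>
    intro y p hne hp hlen
    rcases eq_or_ne y x with rfl | hyx
    · exact ⟨p, hne, hp⟩
    · obtain ⟨w, q, hq, hql⟩ := key p hp hyx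
      -- The trail already has at least `A.ncard` edges, so its extension is too long.
      have := length_le_of_isTrailIn q hq
      omega
  | succ n ih =>
    intro y p hne hp hlen
    rcases eq_or_ne y x with rfl | hyx
    · exact ⟨p, hne, hp⟩
    · obtain ⟨w, q, hq, hql⟩ := key p hp hyx
      exact ih q (by intro h; simp [h] at hql) hq (by omega)

theorem exists_closed_trail [Finite E] (hG : ∀ e, (G.ends e).ncard = 2) {A : Set E}
    (hA : G.EvenOn A) {x : V} {e : E} (he : e ∈ A) (hx : x ∈ G.ends e) :
    ∃ q : G.Walk x x, q.edgeList ≠ [] ∧ q.IsTrailIn A := by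
  obtain ⟨w, hw, hwx⟩ := Set.exists_ne_of_one_lt_ncard (s := G.ends e) (by rw [hG e]; decide) x
  exact exists_closed_of_trail hG hA A.ncard (.cons e ⟨hwx, hw, hx⟩ (.nil x))
    (by simp [Walk.edgeList]) ⟨by simp [Walk.edgeList], by simpa [Walk.edgeList] using he⟩
    (by omega)

theorem exists_maximal_closedTrail [Finite E] {A : Set E}
    (h : ∃ T : G.ClosedTrail, T.edges ⊆ A) :
    ∃ T : G.ClosedTrail, T.edges ⊆ A ∧
      ∀ T' : G.ClosedTrail, T'.edges ⊆ A → T'.walk.length ≤ T.walk.length := by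
  obtain ⟨T₀, hT₀⟩ := h
  let S : Set ℕ := {n | ∃ T : G.ClosedTrail, T.edges ⊆ A ∧ T.walk.length = n}
  have hb : BddAbove S := by
    refine ⟨A.ncard, ?_⟩
    rintro n ⟨T, hT, rfl⟩
    exact length_le_of_isTrailIn T.walk ⟨T.nodup, fun e he => hT he⟩
  have hne : S.Nonempty := ⟨_, T₀, hT₀, rfl⟩
  obtain ⟨T, hT, hTl⟩ := Nat.sSup_mem hne hb
  exact ⟨T, hT, fun T' hT' => hTl ▸ le_csSup hb ⟨T', hT', rfl⟩⟩

/-- Remove a longest closed trail `T` in `A`; all degrees stay even, so induction applies to the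
rest. Anchor-disjointness comes from maximality: a remaining edge at an anchor of `T` would start a
closed trail that could be spliced into `T`. -/
theorem exists_euler_family_on [Finite E] (hG : ∀ e, (G.ends e).ncard = 2) (n : ℕ) :
    ∀ A : Set E, A.ncard = n → G.EvenOn A → ∃ F : Set G.ClosedTrail,
      (F.Pairwise fun T T' => Disjoint T.edges T'.edges ∧ Disjoint T.anchors T'.anchors) ∧
      (∀ T ∈ F, T.edges ⊆ A) ∧ ∀ e ∈ A, ∃ T ∈ F, e ∈ T.edges := by
  induction n using Nat.strong_induction_on with
  | _ n ih =>
  intro A hn hA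
  rcases A.eq_empty_or_nonempty with rfl | ⟨e₀, he₀⟩
  · exact ⟨∅, by simp, by simp, by simp⟩
  have hex : ∃ T : G.ClosedTrail, T.edges ⊆ A := by
    obtain ⟨x, hx⟩ : (G.ends e₀).Nonempty := Set.nonempty_of_ncard_ne_zero (by simp [hG e₀])
    obtain ⟨q, hq, hqA⟩ := exists_closed_trail hG hA he₀ hx
    exact ⟨⟨x, q, q.two_le_length hq, hqA.1⟩, hqA.2⟩
  obtain ⟨T, hTA, hmax⟩ := exists_maximal_closedTrail hex
  have hlt : (A \ T.edges).ncard < n := by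
    rw [← hn]
    obtain ⟨e, he⟩ := List.exists_mem_of_ne_nil _ T.edgeList_ne_nil
    exact Set.ncard_lt_ncard ⟨Set.sdiff_subset, fun h => (h (hTA he)).2 he⟩ (Set.toFinite A)
  have heven : G.EvenOn (A \ T.edges) := by
    intro x
    have h1 := T.walk.even_ncard_stepEnds T.nodup x
    rw [setOf_mem_stepEnds hG _ T.nodup, iff_true_right Iff.rfl] at h1
    have h2 : {e | e ∈ A ∧ x ∈ G.ends e} =
        {e | e ∈ A \ T.edges ∧ x ∈ G.ends e} ∪ {e | e ∈ T.walk.edgeList ∧ x ∈ G.ends e} := by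
      ext e
      have := @hTA e
      simp only [ClosedTrail.edges, Set.mem_ofPred_eq, Set.mem_union, Set.mem_sdiff] at *
      tauto
    have h3 := hA x
    rw [h2, Set.ncard_union_eq (Set.disjoint_left.2 fun e he he' => he.1.2 he'.1)
      (Set.toFinite _) (Set.toFinite _), Nat.even_add] at h3
    exact h3.2 h1
  obtain ⟨F, hF, hFA, hcov⟩ := ih _ hlt _ rfl heven
  refine ⟨insert T F, ?_, ?_, ?_⟩
  · have hdisj : ∀ T' ∈ F, Disjoint T.edges T'.edges ∧ Disjoint T.anchors T'.anchors := by
      intro T' hT'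
      refine ⟨Set.disjoint_left.2 fun e he he' => (hFA T' hT' he').2 he,
        Set.disjoint_left.2 fun z hz hz' => ?_⟩
      obtain ⟨e, he, hze⟩ := T'.walk.exists_mem_stepEnds T'.edgeList_ne_nil hz'
      rw [stepEnds_eq_ends hG _ T'.nodup he] at hze
      obtain ⟨c, hc, hcA⟩ := exists_closed_trail hG heven (hFA T' hT' he) hze
      obtain ⟨q, r, hqr⟩ := T.walk.exists_split hz
      have hperm : (q.append (c.append r)).edgeList.Perm (c.edgeList ++ T.walk.edgeList) := by
        rw [Walk.edgeList_append, Walk.edgeList_append, hqr, ← List.append_assoc,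
          ← List.append_assoc]
        exact List.Perm.append_right _ List.perm_append_comm
      have hnd : (c.edgeList ++ T.walk.edgeList).Nodup :=
        hcA.1.append T.nodup fun f hf hf' => (hcA.2 f hf).2 hf'
      have hlen := hmax ⟨T.base, q.append (c.append r),
        Walk.two_le_length _ fun h => by
          rw [h] at hperm
          exact hc (List.append_eq_nil_iff.1 hperm.symm.eq_nil).1,
        hperm.nodup_iff.2 hnd⟩ fun f hf => by
          rcases List.mem_append.1 (hperm.mem_iff.1 hf) with h | h
          exacts [(hcA.2 f h).1, hTA h]
      have hpos := List.length_pos_of_ne_nil hc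
      simp only [Walk.length, hperm.length_eq, List.length_append] at hlen
      omega
    rw [Set.pairwise_insert]
    exact ⟨hF, fun T' hT' _ => ⟨hdisj T' hT', (hdisj T' hT').1.symm, (hdisj T' hT').2.symm⟩⟩
  · rintro T' (rfl | hT')
    exacts [hTA, (hFA T' hT').trans Set.sdiff_subset]
  · intro e he
    by_cases h : e ∈ T.edges
    · exact ⟨T, Set.mem_insert _ _, h⟩
    · obtain ⟨T', hT', heT'⟩ := hcov e ⟨he, h⟩
      exact ⟨T', Set.mem_insert_of_mem _ hT', heT'⟩

end Multigraph

/-- `H` has a spanning Euler family iff one can select two vertices from each edge in such a way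
that every vertex is selected a positive even number of times. -/
theorem hasSpanningEulerFamily_iff [Finite E] (H : MultiHypergraph V E) :
    H.HasSpanningEulerFamily ↔ ∃ g : E → Set V,
      (∀ e, g e ⊆ H.ends e ∧ (g e).ncard = 2) ∧
      ∀ x, Even {e | x ∈ g e}.ncard ∧ {e | x ∈ g e}.Nonempty := by
  constructor
  · rintro ⟨F, ⟨hpw, hcov⟩, hspan⟩
    have hmem : ∀ {T : H.ClosedTrail} {e x}, x ∈ T.walk.stepEnds e → e ∈ T.edges := by
      intro T e x hx
      by_contra h
      rw [T.walk.stepEnds_eq_empty h] at hx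
      exact hx
    -- All selections of a vertex come from the single trail through it, so its degree can be
    -- computed in that trail.
    have huniq : ∀ {T T' : H.ClosedTrail} {x}, T ∈ F → T' ∈ F → x ∈ T.anchors →
        x ∈ T'.anchors → T = T' := fun hT hT' h h' => (hspan _).unique ⟨hT, h⟩ ⟨hT', h'⟩
    refine ⟨fun e => {x | ∃ T ∈ F, x ∈ T.walk.stepEnds e}, fun e => ?_, fun x => ?_⟩
    · obtain ⟨T, hT, he⟩ := hcov e
      have : {x | ∃ T ∈ F, x ∈ T.walk.stepEnds e} = T.walk.stepEnds e := by
        ext x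
        refine ⟨?_, fun h => ⟨T, hT, h⟩⟩
        rintro ⟨T', hT', hx⟩
        obtain rfl : T' = T := by
          by_contra hne
          exact Set.disjoint_left.1 (hpw hT' hT hne).1 (hmem hx) he
        exact hx
      beta_reduce
      rw [this]
      exact T.walk.stepEnds_of_nodup T.nodup he
    · obtain ⟨T, ⟨hT, hxT⟩, -⟩ := hspan x
      have : {e | x ∈ {x | ∃ T ∈ F, x ∈ T.walk.stepEnds e}} = {e | x ∈ T.walk.stepEnds e} := by
        ext e
        refine ⟨?_, fun h => ⟨T, hT, h⟩⟩
        rintro ⟨T', hT', hx⟩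
        obtain rfl := huniq hT' hT (Walk.mem_anchorList_of_mem_stepEnds _ hx) hxT
        exact hx
      rw [this]
      refine ⟨(T.walk.even_ncard_stepEnds T.nodup x).2 Iff.rfl, ?_⟩
      obtain ⟨e, -, he⟩ := T.walk.exists_mem_stepEnds T.edgeList_ne_nil hxT
      exact ⟨e, he⟩
  · rintro ⟨g, hg, hdeg⟩
    let G : MultiHypergraph V E := ⟨g⟩
    have hG : ∀ e, (G.ends e).ncard = 2 := fun e => (hg e).2
    have hle : ∀ e, G.ends e ⊆ H.ends e := fun e => (hg e).1
    obtain ⟨F, hpw, -, hcov⟩ := exists_euler_family_on hG _ Set.univ rfl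
      fun x => by simpa using (hdeg x).1
    refine ⟨ClosedTrail.mapLe hle '' F, ⟨?_, fun e => ?_⟩, fun x => ?_⟩
    · rintro _ ⟨T, hT, rfl⟩ _ ⟨T', hT', rfl⟩ hne
      simp only [ClosedTrail.edges_mapLe, ClosedTrail.anchors_mapLe]
      exact hpw hT hT' fun h => hne (by rw [h])
    · obtain ⟨T, hT, he⟩ := hcov e trivial
      exact ⟨_, ⟨T, hT, rfl⟩, by rwa [ClosedTrail.edges_mapLe]⟩
    · obtain ⟨e, he⟩ := (hdeg x).2
      obtain ⟨T, hT, heT⟩ := hcov e trivial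
      have hxT : x ∈ T.anchors := Walk.mem_anchorList_of_mem_stepEnds T.walk (e := e)
        (by rwa [stepEnds_eq_ends hG _ T.nodup heT])
      refine ⟨T.mapLe hle, ⟨⟨T, hT, rfl⟩, by rwa [ClosedTrail.anchors_mapLe]⟩, ?_⟩
      rintro _ ⟨⟨T', hT', rfl⟩, hx'⟩
      rw [ClosedTrail.anchors_mapLe] at hx'
      by_contra hne
      exact Set.disjoint_left.1 (hpw hT' hT fun h => hne (by rw [h])).2 hx' hxT

/-! ### Even selections in an ambient vertex and edge type -/

/-- The number of edges in `A` from which the vertex `x` is selected. -/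
noncomputable def selDegree (A : Set E) (g : E → Set V) (x : V) : ℕ :=
  {e | e ∈ A ∧ x ∈ g e}.ncard

/-- `g` selects two vertices of every edge in `A`, and every vertex in `W` is selected a positive
even number of times. -/
def IsEvenSelection (ends : E → Set V) (A : Set E) (W : Set V) (g : E → Set V) : Prop :=
  (∀ e ∈ A, g e ⊆ ends e ∧ (g e).ncard = 2) ∧
    ∀ x ∈ W, Even (selDegree A g x) ∧ 0 < selDegree A g x

theorem selDegree_congr {A : Set E} {g g' : E → Set V} (h : ∀ e ∈ A, g e = g' e) (x : V) :
    selDegree A g x = selDegree A g' x := by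
  unfold selDegree
  congr 1
  ext e
  exact and_congr_right fun he => by rw [h e he]

theorem IsEvenSelection.congr {ends : E → Set V} {A : Set E} {W : Set V} {g g' : E → Set V}
    (hg : IsEvenSelection ends A W g) (h : ∀ e ∈ A, g e = g' e) :
    IsEvenSelection ends A W g' :=
  ⟨fun e he => h e he ▸ hg.1 e he, fun x hx => selDegree_congr h x ▸ hg.2 x hx⟩

theorem selDegree_eq_zero {A : Set E} {g : E → Set V} {x : V}
    (h : ∀ e ∈ A, x ∉ g e) : selDegree A g x = 0 := by
  have : {e | e ∈ A ∧ x ∈ g e} = ∅ := by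
    ext e
    simpa using h e
  rw [selDegree, this, Set.ncard_empty]

/-- The pieces have subtypes as vertex and edge types. Transporting their selections to common
ambient types lets them be compared and glued. -/
theorem hasSpanningEulerFamily_iff_isEvenSelection {V' E' : Type*} [Finite E]
    (K : MultiHypergraph V' E') {φ : V' → V} {ψ : E' → E} (hφ : Function.Injective φ)
    (hψ : Function.Injective ψ) (ends : E → Set V) (h : ∀ e, φ '' K.ends e = ends (ψ e)) :
    K.HasSpanningEulerFamily ↔
      ∃ g, IsEvenSelection ends (Set.range ψ) (Set.range φ) g := by
  have : Finite E' := Finite.of_injective ψ hψ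
  rw [hasSpanningEulerFamily_iff]
  constructor
  · rintro ⟨g, hg, hdeg⟩
    refine ⟨fun e => {x | ∃ e' y, ψ e' = e ∧ φ y = x ∧ y ∈ g e'}, ?_, ?_⟩
    · rintro _ ⟨e', rfl⟩
      have : {x | ∃ e'' y, ψ e'' = ψ e' ∧ φ y = x ∧ y ∈ g e''} = φ '' g e' := by
        ext x
        constructor
        · rintro ⟨e'', y, he, rfl, hy⟩
          exact ⟨y, hψ he ▸ hy, rfl⟩
        · rintro ⟨y, hy, rfl⟩
          exact ⟨e', y, rfl, rfl, hy⟩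
      beta_reduce
      rw [this, ← h, Set.ncard_image_of_injective _ hφ]
      exact ⟨Set.image_mono (hg e').1, (hg e').2⟩
    · rintro _ ⟨y, rfl⟩
      have : {e | e ∈ Set.range ψ ∧ φ y ∈ {x | ∃ e' y, ψ e' = e ∧ φ y = x ∧ y ∈ g e'}} =
          ψ '' {e' | y ∈ g e'} := by
        ext e
        constructor
        · rintro ⟨-, e', z, rfl, hz, hzg⟩
          exact ⟨e', hφ hz ▸ hzg, rfl⟩
        · rintro ⟨e', hy, rfl⟩
          exact ⟨⟨e', rfl⟩, e', y, rfl, rfl, hy⟩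
      rw [selDegree, this, Set.ncard_image_of_injective _ hψ]
      exact ⟨(hdeg y).1, (Set.ncard_pos (Set.toFinite _)).2 (hdeg y).2⟩
  · rintro ⟨g, hg, hdeg⟩
    refine ⟨fun e' => φ ⁻¹' g (ψ e'), fun e' => ?_, fun y => ?_⟩
    · obtain ⟨h1, h2⟩ := hg (ψ e') ⟨e', rfl⟩
      rw [← h] at h1
      have h3 : φ '' (φ ⁻¹' g (ψ e')) = g (ψ e') :=
        Set.image_preimage_eq_of_subset (h1.trans (Set.image_subset_range _ _))
      refine ⟨?_, ?_⟩
      · rw [← Set.image_subset_image_iff hφ, h3]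
        exact h1
      · rw [← Set.ncard_image_of_injective _ hφ, h3, h2]
    · obtain ⟨h1, h2⟩ := hdeg (φ y) ⟨y, rfl⟩
      have : {e | e ∈ Set.range ψ ∧ φ y ∈ g e} = ψ '' {e' | y ∈ φ ⁻¹' g (ψ e')} := by
        ext e
        constructor
        · rintro ⟨⟨e', rfl⟩, hy⟩
          exact ⟨e', hy, rfl⟩
        · rintro ⟨e', hy, rfl⟩
          exact ⟨⟨e', rfl⟩, hy⟩
      rw [selDegree, this, Set.ncard_image_of_injective _ hψ] at h1 h2
      exact ⟨h1, (Set.ncard_pos (Set.toFinite _)).1 h2⟩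

/-! ### Parallel copies of a two-vertex edge, and the handshake lemma -/

section Pair

variable {ends : E → Set V} {A B D : Set E} {W : Set V} {g : E → Set V} {a b : V}

theorem eq_pair_of_subset {s t : Set V} (hs : s.ncard = 2) (hst : s ⊆ t)
    (ht : t ⊆ {a, b}) (hab : a ≠ b) : t = {a, b} ∧ s = {a, b} := by
  have h : s = {a, b} := Set.eq_of_subset_of_ncard_le (hst.trans ht)
    (by rw [hs, Set.ncard_pair hab]) (Set.toFinite _)
  exact ⟨ht.antisymm (h ▸ hst), h⟩

theorem selDegree_union [Finite E] (hBD : Disjoint B D) (x : V) :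
    selDegree (B ∪ D) g x = selDegree B g x + selDegree D g x := by
  unfold selDegree
  rw [← Set.ncard_union_eq (Set.disjoint_left.2 fun e he he' =>
    Set.disjoint_left.1 hBD he.1 he'.1) (Set.toFinite _) (Set.toFinite _)]
  congr 1
  ext e
  simp only [Set.mem_union, Set.mem_ofPred_eq]
  tauto

theorem selDegree_of_mem {x : V} (h : ∀ e ∈ D, x ∈ g e) : selDegree D g x = D.ncard := by
  unfold selDegree
  congr 1
  ext e
  exact ⟨fun he => he.1, fun he => ⟨he, h e he⟩⟩

/-- The selection on `D` is forced, adds `D.ncard` to the degrees of `a` and `b`, and affects no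
vertex of `W`. Positivity at `a` and `b` is free because `D` is nonempty. -/
theorem isEvenSelection_union_pair_iff [Finite E] (hab : a ≠ b) (haW : a ∉ W) (hbW : b ∉ W)
    (hBD : Disjoint B D) (hD : D.Nonempty) (hDe : ∀ e ∈ D, ends e = {a, b}) :
    IsEvenSelection ends (B ∪ D) (W ∪ {a, b}) g ↔
      IsEvenSelection ends B W g ∧ (∀ e ∈ D, g e = {a, b}) ∧
        Even (selDegree B g a + D.ncard) ∧ Even (selDegree B g b + D.ncard) := by
  have hpos : 0 < D.ncard := (Set.ncard_pos (Set.toFinite _)).2 hD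
  have hdegW : (∀ e ∈ D, g e = {a, b}) → ∀ x ∈ W,
      selDegree (B ∪ D) g x = selDegree B g x := by
    intro hg x hx
    rw [selDegree_union hBD, selDegree_eq_zero (A := D), add_zero]
    rintro e he hxe
    rw [hg e he] at hxe
    rcases hxe with rfl | rfl
    exacts [haW hx, hbW hx]
  have hdeg : (∀ e ∈ D, g e = {a, b}) → ∀ x ∈ ({a, b} : Set V),
      selDegree (B ∪ D) g x = selDegree B g x + D.ncard := by
    intro hg x hx
    rw [selDegree_union hBD, selDegree_of_mem (D := D)]
    intro e he
    rwa [hg e he]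
  constructor
  · rintro ⟨h1, h2⟩
    have hg : ∀ e ∈ D, g e = {a, b} := fun e he =>
      (eq_pair_of_subset (h1 e (Or.inr he)).2 (h1 e (Or.inr he)).1 (hDe e he).le hab).2
    refine ⟨⟨fun e he => h1 e (Or.inl he), fun x hx => ?_⟩, hg, ?_, ?_⟩
    · rw [← hdegW hg x hx]
      exact h2 x (Or.inl hx)
    · rw [← hdeg hg a (by simp)]
      exact (h2 a (by simp)).1
    · rw [← hdeg hg b (by simp)]
      exact (h2 b (by simp)).1
  · rintro ⟨⟨h1, h2⟩, hg, ha, hb⟩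
    refine ⟨?_, ?_⟩
    · rintro e (he | he)
      · exact h1 e he
      · rw [hg e he, hDe e he]
        exact ⟨subset_rfl, Set.ncard_pair hab⟩
    · rintro x (hx | hx)
      · rw [hdegW hg x hx]
        exact h2 x hx
      · rw [hdeg hg x hx]
        refine ⟨?_, by omega⟩
        rcases hx with rfl | rfl
        exacts [ha, hb]

/-- The handshake lemma, for a selection all of whose vertices but `a` and `b` have even degree. -/
theorem IsEvenSelection.even_add [Finite V] [Finite E] (hg : IsEvenSelection ends A W g)
    (hab : a ≠ b) (hA : ∀ e ∈ A, ends e ⊆ W ∪ {a, b}) :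
    Even (selDegree A g a + selDegree A g b) := by
  classical
  have := Fintype.ofFinite V
  have := Fintype.ofFinite E
  have hdeg : ∀ x, selDegree A g x =
      (Finset.bipartiteAbove (fun x e => x ∈ g e) (Finset.univ.filter (· ∈ A)) x).card := by
    intro x
    rw [selDegree, ← Set.ncard_coe_finset]
    congr 1
    ext e
    simp [Finset.bipartiteAbove]
  -- Double counting of selected incidences: each edge of `A` contributes two.
  have hsum : ∑ x, selDegree A g x = ∑ e ∈ Finset.univ.filter (· ∈ A), 2 := by
    simp_rw [hdeg]
    rw [Finset.sum_card_bipartiteAbove_eq_sum_card_bipartiteBelow]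
    refine Finset.sum_congr rfl fun e he => ?_
    rw [← (hg.1 e (by simpa using he)).2, ← Set.ncard_coe_finset]
    congr 1
    ext x
    simp [Finset.bipartiteBelow]
  have heven : Even (∑ x, selDegree A g x) := by
    rw [hsum]
    exact Finset.even_sum _ fun _ _ => even_two
  have hrest : Even (∑ x ∈ (Finset.univ.erase a).erase b, selDegree A g x) := by
    refine Finset.even_sum _ fun x hx => ?_
    simp only [Finset.mem_erase, Finset.mem_univ, and_true] at hx
    by_cases hxW : x ∈ W
    · exact (hg.2 x hxW).1
    · rw [selDegree_eq_zero]
      · exact Even.zero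
      · intro e he hxe
        rcases hA e he ((hg.1 e he).1 hxe) with h | h | h
        exacts [hxW h, hx.2 h, hx.1 h]
  rw [← Finset.add_sum_erase _ _ (Finset.mem_univ a),
    ← Finset.add_sum_erase _ _ (Finset.mem_erase.2 ⟨hab.symm, Finset.mem_univ b⟩),
    ← add_assoc, Nat.even_add] at heven
  exact heven.2 hrest

end Pair

/-! ### The pieces of a hypergraph at a vertex set of size two -/

section Cut

variable (H : MultiHypergraph V E) {S : Set V}

/-- The edges that meet `W`. -/
def edgesMeeting (W : Set V) : Set E := {e | (H.ends e ∩ W).Nonempty}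

/-- The vertices of a component of `H \ S`, as vertices of `H`. -/
def compVerts (i : (H.deleteVerts S).Component) : Set V := Subtype.val '' i.verts

variable {H}

theorem disjoint_compVerts (i : (H.deleteVerts S).Component) : Disjoint (H.compVerts i) S := by
  rw [Set.disjoint_left]
  rintro _ ⟨x, -, rfl⟩
  exact x.2

theorem eq_of_mem_compVerts {i j : (H.deleteVerts S).Component} {x : V}
    (hi : x ∈ H.compVerts i) (hj : x ∈ H.compVerts j) : i = j := by
  obtain ⟨y, hy, rfl⟩ := hi
  obtain ⟨z, hz, hzy⟩ := hj
  obtain rfl := Subtype.ext hzy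
  exact hy.symm.trans hz

theorem exists_mem_compVerts {x : V} (hx : x ∉ S) :
    ∃ i : (H.deleteVerts S).Component, x ∈ H.compVerts i :=
  ⟨Quotient.mk _ ⟨x, hx⟩, ⟨x, hx⟩, rfl, rfl⟩

/-- Two distinct vertices of one edge, both outside `S`, are adjacent in `H \ S` and so lie in the
same component. -/
theorem ends_subset_sVerts {i : (H.deleteVerts S).Component} {e : E}
    (he : e ∈ H.edgesMeeting (H.compVerts i)) : H.ends e ⊆ H.sVerts S i := by
  obtain ⟨_, hx, ⟨x, hxi, rfl⟩⟩ := he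
  intro y hy
  by_cases hyS : y ∈ S
  · exact Or.inr hyS
  · refine Or.inl ⟨⟨y, hyS⟩, ?_, rfl⟩
    have hr : (H.deleteVerts S).Reachable ⟨y, hyS⟩ x := by
      by_cases hxy : (⟨y, hyS⟩ : (Sᶜ : Set V)) = x
      · rw [hxy]
        exact ⟨.nil x⟩
      · exact ⟨.cons ⟨e, y, hy, hyS⟩ ⟨hxy, hy, hx⟩ (.nil x)⟩
    exact (Quotient.sound hr : _ = _).trans hxi

theorem eq_of_mem_edgesMeeting {i j : (H.deleteVerts S).Component} {e : E}
    (hi : e ∈ H.edgesMeeting (H.compVerts i)) (hj : e ∈ H.edgesMeeting (H.compVerts j)) :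
    i = j := by
  obtain ⟨x, hxe, hx⟩ := hj
  rcases ends_subset_sVerts hi hxe with h | h
  · exact eq_of_mem_compVerts h hx
  · exact absurd h (Set.disjoint_left.1 (disjoint_compVerts j) hx)

theorem exists_mem_edgesMeeting {e : E} (he : ¬ H.ends e ⊆ S) :
    ∃ i : (H.deleteVerts S).Component, e ∈ H.edgesMeeting (H.compVerts i) := by
  obtain ⟨x, hx, hxS⟩ := Set.not_subset.1 he
  obtain ⟨i, hi⟩ := exists_mem_compVerts (H := H) hxS
  exact ⟨i, x, hx, hi⟩

theorem not_subset_of_mem_edgesMeeting {i : (H.deleteVerts S).Component} {e : E}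
    (he : e ∈ H.edgesMeeting (H.compVerts i)) : ¬ H.ends e ⊆ S := by
  obtain ⟨x, hx, hxi⟩ := he
  exact fun h => Set.disjoint_left.1 (disjoint_compVerts i) hxi (h hx)

variable {a b : V}

theorem edges_sComponent_eq (hne : ∀ e, (H.ends e).Nonempty)
    (hsub : ∀ e, H.ends e ⊆ S → H.ends e = S) (i : (H.deleteVerts S).Component) :
    {e | H.ends e ⊆ H.sVerts S i ∧ H.ends e ≠ ∅} =
      H.edgesMeeting (H.compVerts i) ∪ {e | H.ends e = S} := by
  ext e
  constructor
  · rintro ⟨h, -⟩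
    by_cases he : H.ends e ⊆ S
    · exact Or.inr (hsub e he)
    · obtain ⟨x, hx, hxS⟩ := Set.not_subset.1 he
      exact Or.inl ⟨x, hx, (h hx).resolve_right hxS⟩
  · rintro (h | h)
    · exact ⟨ends_subset_sVerts h, (hne e).ne_empty⟩
    · exact ⟨fun x hx => Or.inr (h ▸ hx), (hne e).ne_empty⟩

theorem disjoint_edgesMeeting (i : (H.deleteVerts S).Component) :
    Disjoint (H.edgesMeeting (H.compVerts i)) {e | H.ends e = S} :=
  Set.disjoint_left.2 fun _ he he' => not_subset_of_mem_edgesMeeting he (le_of_eq he')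

theorem image_val_ends (i : (H.deleteVerts S).Component)
    (e : {e : E // H.ends e ⊆ H.sVerts S i ∧ H.ends e ≠ ∅}) :
    Subtype.val '' ((H.sComponent S i).ends e) = H.ends e := by
  ext x
  exact ⟨by rintro ⟨y, hy, rfl⟩; exact hy, fun hx => ⟨⟨x, e.2.1 hx⟩, hx, rfl⟩⟩

theorem notMem_compVerts_left (i : (H.deleteVerts {a, b}).Component) : a ∉ H.compVerts i :=
  fun h => Set.disjoint_left.1 (disjoint_compVerts i) h (by simp)

theorem notMem_compVerts_right (i : (H.deleteVerts {a, b}).Component) : b ∉ H.compVerts i :=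
  fun h => Set.disjoint_left.1 (disjoint_compVerts i) h (by simp)

theorem selDegree_eq_selDegree_compVerts {A : Set E} {g : E → Set V}
    (hA : ∀ i : (H.deleteVerts S).Component, H.edgesMeeting (H.compVerts i) ⊆ A)
    (hg : ∀ e ∈ A, g e ⊆ H.ends e) {i : (H.deleteVerts S).Component} {x : V}
    (hx : x ∈ H.compVerts i) :
    selDegree A g x = selDegree (H.edgesMeeting (H.compVerts i)) g x := by
  unfold selDegree
  congr 1
  ext e
  exact ⟨fun h => ⟨⟨x, hg e h.1 h.2, hx⟩, h.2⟩, fun h => ⟨hA i h.1, h.2⟩⟩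

theorem edgesMeeting_compl :
    H.edgesMeeting Sᶜ = ⋃ i : (H.deleteVerts S).Component, H.edgesMeeting (H.compVerts i) := by
  ext e
  rw [Set.mem_iUnion]
  constructor
  · rintro ⟨x, hx, hxS⟩
    exact exists_mem_edgesMeeting fun h => hxS (h hx)
  · rintro ⟨i, x, hx, hxi⟩
    exact ⟨x, hx, Set.disjoint_left.1 (disjoint_compVerts i) hxi⟩

theorem isEvenSelection_compl_iff {g : E → Set V} :
    IsEvenSelection H.ends (H.edgesMeeting Sᶜ) Sᶜ g ↔
      ∀ i : (H.deleteVerts S).Component,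
        IsEvenSelection H.ends (H.edgesMeeting (H.compVerts i)) (H.compVerts i) g := by
  have hA : ∀ i : (H.deleteVerts S).Component,
      H.edgesMeeting (H.compVerts i) ⊆ H.edgesMeeting Sᶜ := by
    intro i
    rw [edgesMeeting_compl]
    exact Set.subset_iUnion_of_subset i subset_rfl
  constructor
  · intro hg i
    refine ⟨fun e he => hg.1 e (hA i he), fun x hx => ?_⟩
    rw [← selDegree_eq_selDegree_compVerts hA (fun e he => (hg.1 e he).1) hx]
    exact hg.2 x (Set.disjoint_left.1 (disjoint_compVerts i) hx)
  · intro hg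
    have h1 : ∀ e ∈ H.edgesMeeting Sᶜ, g e ⊆ H.ends e ∧ (g e).ncard = 2 := by
      intro e he
      rw [edgesMeeting_compl, Set.mem_iUnion] at he
      obtain ⟨i, hi⟩ := he
      exact (hg i).1 e hi
    refine ⟨h1, fun x hx => ?_⟩
    obtain ⟨i, hi⟩ := exists_mem_compVerts (H := H) hx
    rw [selDegree_eq_selDegree_compVerts hA (fun e he => (h1 e he).1) hi]
    exact (hg i).2 x hi

/-! ### Spanning Euler families of the pieces as parity conditions at the cut -/

variable [Finite E]

/-- The odd number of copies of `S` reverses the parities at `a` and `b`. The first clause is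
necessary because a one-vertex edge inside `S` belongs to every `S`-component and admits no
selection. -/
theorem sComponent_iff (hne : ∀ e, (H.ends e).Nonempty) (hab : a ≠ b)
    (hodd : Odd {e : E | H.ends e = {a, b}}.ncard) (i : (H.deleteVerts {a, b}).Component) :
    (H.sComponent {a, b} i).HasSpanningEulerFamily ↔
      (∀ e, H.ends e ⊆ {a, b} → H.ends e = {a, b}) ∧
        ∃ g, IsEvenSelection H.ends (H.edgesMeeting (H.compVerts i)) (H.compVerts i) g ∧
          Odd (selDegree (H.edgesMeeting (H.compVerts i)) g a) ∧
          Odd (selDegree (H.edgesMeeting (H.compVerts i)) g b) := by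
  have hD : {e : E | H.ends e = {a, b}}.Nonempty := Set.nonempty_of_ncard_ne_zero hodd.pos.ne'
  have key := fun (hsub : ∀ e, H.ends e ⊆ {a, b} → H.ends e = {a, b}) g =>
    (edges_sComponent_eq hne hsub i).symm ▸ isEvenSelection_union_pair_iff (g := g)
      (ends := H.ends) hab (notMem_compVerts_left i) (notMem_compVerts_right i)
      (disjoint_edgesMeeting i) hD fun e he => he
  rw [hasSpanningEulerFamily_iff_isEvenSelection _ Subtype.val_injective Subtype.val_injective
    H.ends (image_val_ends i), Subtype.range_val, Subtype.range_coe_subtype]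
  constructor
  · rintro ⟨g, hg⟩
    have hsub : ∀ e, H.ends e ⊆ {a, b} → H.ends e = {a, b} := fun e he => by
      obtain ⟨h1, h2⟩ := hg.1 e ⟨fun x hx => Or.inr (he hx), (hne e).ne_empty⟩
      exact (eq_pair_of_subset h2 h1 he hab).1
    obtain ⟨h1, -, h3, h4⟩ := (key hsub g).1 hg
    rw [Nat.even_add'] at h3 h4
    exact ⟨hsub, g, h1, h3.2 hodd, h4.2 hodd⟩
  · rintro ⟨hsub, g, hg, ha, hb⟩
    classical
    -- The values of `g` on copies of `S` are arbitrary; resetting them to `{a, b}` does not disturb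
    -- the edges that meet the component.
    have hc : ∀ e ∈ H.edgesMeeting (H.compVerts i),
        g e = if H.ends e = {a, b} then {a, b} else g e := fun e he => by
      rw [if_neg fun h => not_subset_of_mem_edgesMeeting he h.le]
    refine ⟨fun e => if H.ends e = {a, b} then {a, b} else g e, (key hsub _).2
      ⟨hg.congr hc, fun e he => if_pos he, ?_, ?_⟩⟩
    · rw [← selDegree_congr hc]
      exact ha.add_odd hodd
    · rw [← selDegree_congr hc]
      exact hb.add_odd hodd

/-- Edges are trimmed to the component, so `a` and `b` are never selected and have degree zero. The
clause about edges inside `S` cannot be recovered here, since such edges are absent. -/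
theorem exists_of_componentGraph (i : (H.deleteVerts {a, b}).Component)
    (h : ((H.deleteVerts {a, b}).componentGraph i).HasSpanningEulerFamily) :
    ∃ g, IsEvenSelection H.ends (H.edgesMeeting (H.compVerts i)) (H.compVerts i) g ∧
      Even (selDegree (H.edgesMeeting (H.compVerts i)) g a) ∧
      Even (selDegree (H.edgesMeeting (H.compVerts i)) g b) := by
  rw [hasSpanningEulerFamily_iff_isEvenSelection _
    (Subtype.val_injective.comp Subtype.val_injective)
    (Subtype.val_injective.comp Subtype.val_injective)
    (fun e => H.ends e ∩ H.compVerts i)] at h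
  · obtain ⟨g, hg⟩ := h
    have hV : Set.range (Subtype.val ∘ Subtype.val : i.verts → V) = H.compVerts i := by
      rw [Set.range_comp, Subtype.range_val]
      rfl
    have hE : Set.range (Subtype.val ∘ Subtype.val :
        {e : {e : E // (H.ends e ∩ {a, b}ᶜ).Nonempty} //
          ((H.deleteVerts {a, b}).ends e ∩ i.verts).Nonempty} → E) =
        H.edgesMeeting (H.compVerts i) := by
      ext e
      constructor
      · rintro ⟨⟨⟨e, h1⟩, x, hx, hxi⟩, rfl⟩
        exact ⟨x, hx, x, hxi, rfl⟩
      · rintro ⟨_, hx, x, hxi, rfl⟩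
        exact ⟨⟨⟨e, x, hx, x.2⟩, x, hx, hxi⟩, rfl⟩
    rw [hV, hE] at hg
    have h0 : ∀ x, x ∉ H.compVerts i → Even (selDegree (H.edgesMeeting (H.compVerts i)) g x) := by
      intro x hx
      rw [selDegree_eq_zero]
      · exact Even.zero
      · exact fun e he hxe => hx ((hg.1 e he).1 hxe).2
    exact ⟨g, ⟨fun e he => ⟨(hg.1 e he).1.trans Set.inter_subset_left, (hg.1 e he).2⟩, hg.2⟩,
      h0 a (notMem_compVerts_left i), h0 b (notMem_compVerts_right i)⟩
  · intro e
    ext x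
    constructor
    · rintro ⟨y, hy, rfl⟩
      exact ⟨hy, y.1, y.2, rfl⟩
    · rintro ⟨hx, y, hy, rfl⟩
      exact ⟨⟨y, hy⟩, hx, rfl⟩

theorem sStarComponent_iff (hne : ∀ e, (H.ends e).Nonempty) (hab : a ≠ b)
    (hodd : Odd {e : E | H.ends e = {a, b}}.ncard) (i : (H.deleteVerts {a, b}).Component) :
    (H.sStarComponent {a, b} i).HasSpanningEulerFamily ↔
      (∀ e, H.ends e ⊆ {a, b} → H.ends e = {a, b}) ∧
        ∃ g, IsEvenSelection H.ends (H.edgesMeeting (H.compVerts i)) (H.compVerts i) g ∧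
          Even (selDegree (H.edgesMeeting (H.compVerts i)) g a) ∧
          Even (selDegree (H.edgesMeeting (H.compVerts i)) g b) := by
  classical
  -- Exactly one copy of `S` is adjoined, making the total number of copies even.
  have hn : ({a, b} : Set V).ncard / 2 = 1 := by rw [Set.ncard_pair hab]
  let ends : E ⊕ Fin (({a, b} : Set V).ncard / 2) → Set V := Sum.elim H.ends fun _ => {a, b}
  let D : Set (E ⊕ Fin (({a, b} : Set V).ncard / 2)) :=
    Sum.inl '' {e | H.ends e = {a, b}} ∪ Set.range Sum.inr
  let B : Set (E ⊕ Fin (({a, b} : Set V).ncard / 2)) :=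
    Sum.inl '' H.edgesMeeting (H.compVerts i)
  have hDcard : D.ncard = {e : E | H.ends e = {a, b}}.ncard + 1 := by
    rw [Set.ncard_union_eq _ (Set.toFinite _) (Set.toFinite _),
      Set.ncard_image_of_injective _ Sum.inl_injective, ← Set.image_univ,
      Set.ncard_image_of_injective _ Sum.inr_injective, Set.ncard_univ, Nat.card_fin, hn]
    rw [Set.disjoint_left]
    rintro _ ⟨e, -, rfl⟩ ⟨n, hn⟩
    cases hn
  have hDeven : Even D.ncard := hDcard ▸ hodd.add_odd odd_one
  have hD : D.Nonempty := Set.nonempty_of_ncard_ne_zero (by omega)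
  have hDe : ∀ e ∈ D, ends e = {a, b} := by
    rintro _ (⟨e, he, rfl⟩ | ⟨n, rfl⟩)
    exacts [he, rfl]
  have hBD : Disjoint B D := by
    rw [Set.disjoint_left]
    rintro _ ⟨e, he, rfl⟩ (⟨f, hf, hef⟩ | ⟨n, hn⟩)
    · obtain rfl := Sum.inl_injective hef
      exact Set.disjoint_left.1 (disjoint_edgesMeeting i) he hf
    · cases hn
  have hdeg : ∀ (g : _ → Set V) x, selDegree B g x =
      selDegree (H.edgesMeeting (H.compVerts i)) (g ∘ Sum.inl) x := by
    intro g x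
    unfold selDegree
    rw [← Set.ncard_image_of_injective {e | e ∈ H.edgesMeeting (H.compVerts i) ∧ _}
      (Sum.inl_injective (β := Fin (({a, b} : Set V).ncard / 2)))]
    congr 1
    ext e
    constructor
    · rintro ⟨⟨e, he, rfl⟩, hx⟩
      exact ⟨e, ⟨he, hx⟩, rfl⟩
    · rintro ⟨e, ⟨he, hx⟩, rfl⟩
      exact ⟨⟨e, he, rfl⟩, hx⟩
  have hsel : ∀ g, IsEvenSelection ends B (H.compVerts i) g ↔ IsEvenSelection H.ends
      (H.edgesMeeting (H.compVerts i)) (H.compVerts i) (g ∘ Sum.inl) := by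
    intro g
    unfold IsEvenSelection
    simp only [hdeg]
    refine and_congr_left fun _ => ⟨fun h e he => h (Sum.inl e) ⟨e, he, rfl⟩, ?_⟩
    rintro h _ ⟨e, he, rfl⟩
    exact h e he
  let ψ : {e : E // H.ends e ⊆ H.sVerts {a, b} i ∧ H.ends e ≠ ∅} ⊕
      Fin (({a, b} : Set V).ncard / 2) → E ⊕ Fin (({a, b} : Set V).ncard / 2) :=
    Sum.map Subtype.val id
  have hψ : Function.Injective ψ :=
    Function.Injective.sumMap Subtype.val_injective Function.injective_id
  have hr : (∀ e, H.ends e ⊆ {a, b} → H.ends e = {a, b}) → Set.range ψ = B ∪ D := by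
    intro hsub
    rw [show ψ = Sum.elim (Sum.inl ∘ Subtype.val) Sum.inr from rfl, Set.Sum.elim_range,
      Set.range_comp, Subtype.range_coe_subtype, edges_sComponent_eq hne hsub i,
      Set.image_union, Set.union_assoc]
  have key := fun (hsub : ∀ e, H.ends e ⊆ {a, b} → H.ends e = {a, b}) g =>
    (hr hsub).symm ▸ isEvenSelection_union_pair_iff (g := g) (ends := ends) hab
      (notMem_compVerts_left i) (notMem_compVerts_right i) hBD hD hDe
  rw [hasSpanningEulerFamily_iff_isEvenSelection _ Subtype.val_injective hψ ends,
    Subtype.range_val]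
  · constructor
    · rintro ⟨g, hg⟩
      have hsub : ∀ e, H.ends e ⊆ {a, b} → H.ends e = {a, b} := fun e he => by
        obtain ⟨h1, h2⟩ := hg.1 (Sum.inl e)
          ⟨Sum.inl ⟨e, fun x hx => Or.inr (he hx), (hne e).ne_empty⟩, rfl⟩
        exact (eq_pair_of_subset h2 h1 he hab).1
      obtain ⟨h1, -, h3, h4⟩ := (key hsub g).1 hg
      rw [Nat.even_add, hdeg] at h3 h4
      exact ⟨hsub, _, (hsel g).1 h1, h3.2 hDeven, h4.2 hDeven⟩
    · rintro ⟨hsub, g, hg, ha, hb⟩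
      have hc : ∀ e ∈ H.edgesMeeting (H.compVerts i),
          g e = if H.ends e = {a, b} then {a, b} else g e := fun e he => by
        rw [if_neg fun h => not_subset_of_mem_edgesMeeting he h.le]
      refine ⟨Sum.elim (fun e => if H.ends e = {a, b} then {a, b} else g e) fun _ => {a, b},
        (key hsub _).2 ⟨(hsel _).2 (hg.congr hc), ?_, ?_, ?_⟩⟩
      · rintro _ (⟨e, he, rfl⟩ | ⟨n, rfl⟩)
        exacts [if_pos he, rfl]
      · rw [hdeg, Sum.elim_comp_inl, ← selDegree_congr hc]
        exact ha.add hDeven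
      · rw [hdeg, Sum.elim_comp_inl, ← selDegree_congr hc]
        exact hb.add hDeven
  · rintro (e | n)
    · exact image_val_ends i e
    · ext x
      exact ⟨by rintro ⟨y, hy, rfl⟩; exact hy, fun hx => ⟨⟨x, Or.inr hx⟩, hx, rfl⟩⟩

/-- The components partition the edges not contained in `S`, so the degree is a sum over components,
odd exactly when an odd number of terms are. -/
theorem odd_selDegree_compl_iff [Finite V] (g : E → Set V) (x : V) :
    Odd (selDegree (H.edgesMeeting Sᶜ) g x) ↔
      Odd {i : (H.deleteVerts S).Component |
        Odd (selDegree (H.edgesMeeting (H.compVerts i)) g x)}.ncard := by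
  classical
  have : Finite (H.deleteVerts S).Component :=
    inferInstanceAs (Finite (Quotient (H.deleteVerts S).reachableSetoid))
  have := Fintype.ofFinite (H.deleteVerts S).Component
  have := Fintype.ofFinite E
  have hsum : selDegree (H.edgesMeeting Sᶜ) g x =
      ∑ i : (H.deleteVerts S).Component, selDegree (H.edgesMeeting (H.compVerts i)) g x := by
    simp only [selDegree, Set.ncard_eq_toFinset_card']
    rw [← Finset.card_biUnion]
    · congr 1
      ext e
      rw [edgesMeeting_compl]
      simp
    · intro i _ j _ hij
      refine Finset.disjoint_left.2 ?_
      intro e he he'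
      simp only [Set.mem_toFinset] at he he'
      exact hij (eq_of_mem_edgesMeeting he.1 he'.1)
  rw [hsum, Finset.odd_sum_iff_odd_card_odd, ← Set.ncard_coe_finset]
  simp

theorem hasSpanningEulerFamily_iff_components [Finite V] (hab : a ≠ b)
    (hodd : Odd {e : E | H.ends e = {a, b}}.ncard) :
    H.HasSpanningEulerFamily ↔
      (∀ e, H.ends e ⊆ {a, b} → H.ends e = {a, b}) ∧
        ∃ g, (∀ i : (H.deleteVerts {a, b}).Component, IsEvenSelection H.ends
            (H.edgesMeeting (H.compVerts i)) (H.compVerts i) g) ∧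
          Odd {i : (H.deleteVerts {a, b}).Component |
            Odd (selDegree (H.edgesMeeting (H.compVerts i)) g a)}.ncard ∧
          Odd {i : (H.deleteVerts {a, b}).Component |
            Odd (selDegree (H.edgesMeeting (H.compVerts i)) g b)}.ncard := by
  classical
  have hD : {e : E | H.ends e = {a, b}}.Nonempty := Set.nonempty_of_ncard_ne_zero hodd.pos.ne'
  have hdisj : Disjoint (H.edgesMeeting {a, b}ᶜ) {e | H.ends e = {a, b}} :=
    Set.disjoint_left.2 fun e ⟨x, hx, hx'⟩ he => hx' (le_of_eq he hx)
  have hE : (∀ e, H.ends e ⊆ {a, b} → H.ends e = {a, b}) →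
      Set.univ = H.edgesMeeting {a, b}ᶜ ∪ {e | H.ends e = {a, b}} := by
    refine fun hsub => (Set.eq_univ_of_forall fun e => ?_).symm
    by_cases he : H.ends e ⊆ {a, b}
    · exact Or.inr (hsub e he)
    · exact Or.inl (Set.not_subset.1 he)
  have key := fun g => isEvenSelection_union_pair_iff (g := g) (ends := H.ends) (W := {a, b}ᶜ)
    hab (by simp) (by simp) hdisj hD fun e he => he
  rw [Set.compl_union_self] at key
  rw [hasSpanningEulerFamily_iff_isEvenSelection H Function.injective_id Function.injective_id
    H.ends (fun e => Set.image_id _), Set.range_id, Set.range_id]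
  constructor
  · rintro ⟨g, hg⟩
    have hsub : ∀ e, H.ends e ⊆ {a, b} → H.ends e = {a, b} := fun e he =>
      (eq_pair_of_subset (hg.1 e trivial).2 (hg.1 e trivial).1 he hab).1
    rw [hE hsub] at hg
    obtain ⟨h1, -, h3, h4⟩ := (key g).1 hg
    rw [Nat.even_add'] at h3 h4
    exact ⟨hsub, g, isEvenSelection_compl_iff.1 h1, (odd_selDegree_compl_iff g a).1 (h3.2 hodd),
      (odd_selDegree_compl_iff g b).1 (h4.2 hodd)⟩
  · rintro ⟨hsub, g, hg, ha, hb⟩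
    have hc : ∀ e ∈ H.edgesMeeting {a, b}ᶜ,
        g e = if H.ends e = {a, b} then {a, b} else g e := fun e he => by
      exact (if_neg fun h : H.ends e = {a, b} => Set.disjoint_left.1 hdisj he h).symm
    rw [hE hsub]
    refine ⟨fun e => if H.ends e = {a, b} then {a, b} else g e, (key _).2
      ⟨(isEvenSelection_compl_iff.2 hg).congr hc, fun e he => if_pos he, ?_, ?_⟩⟩
    · rw [← selDegree_congr hc]
      exact ((odd_selDegree_compl_iff g a).2 ha).add_odd hodd
    · rw [← selDegree_congr hc]
      exact ((odd_selDegree_compl_iff g b).2 hb).add_odd hodd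

end Cut

end MultiHypergraph

/-! ### The main theorem -/

open MultiHypergraph in
theorem theorem3p14 {V : Type*} {E : Type*} [Finite V] [Finite E]
    (H : MultiHypergraph V E) (hne : ∀ e : E, (H.ends e).Nonempty)
    (u v : V) (hS : H.IsKVertexCut 2 {u, v})
    (hodd : Odd {e : E | H.ends e = {u, v}}.ncard) :
    H.HasSpanningEulerFamily ↔
      ∃ J : Set (H.deleteVerts {u, v}).Component,
        Odd J.ncard ∧
        (∀ i ∈ J, (H.sComponent {u, v} i).HasSpanningEulerFamily) ∧
        (∀ i ∉ J, ((H.deleteVerts {u, v}).componentGraph i).HasSpanningEulerFamily ∨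
          (H.sStarComponent {u, v} i).HasSpanningEulerFamily) := by
  classical
  have huv : u ≠ v := by
    rintro rfl
    simpa using hS.2.2
  rw [hasSpanningEulerFamily_iff_components huv hodd]
  constructor
  · rintro ⟨hsub, g, hg, hu, -⟩
    -- The handshake lemma equates the parities at `u` and `v` in each component, so the components
    -- odd at `u` serve as `J` for both vertices.
    have hpar := fun i => Nat.even_add.1 ((hg i).even_add huv fun e he => ends_subset_sVerts he)
    refine ⟨_, hu, fun i hi => ?_, fun i hi => Or.inr ?_⟩
    · refine (sComponent_iff hne huv hodd i).2 ⟨hsub, g, hg i, hi, ?_⟩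
      rw [← Nat.not_even_iff_odd, ← hpar i, Nat.not_even_iff_odd]
      exact hi
    · have hi' := Nat.not_odd_iff_even.1 hi
      exact (sStarComponent_iff hne huv hodd i).2 ⟨hsub, g, hg i, hi', (hpar i).1 hi'⟩
  · rintro ⟨J, hJ, hin, hout⟩
    -- Components outside `J` may say nothing about edges inside `S`; a member of the odd, hence
    -- nonempty, set `J` excludes one-vertex edges there.
    obtain ⟨i₀, hi₀⟩ : J.Nonempty := Set.nonempty_of_ncard_ne_zero hJ.pos.ne'
    have hsub := ((sComponent_iff hne huv hodd i₀).1 (hin i₀ hi₀)).1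
    have hex : ∀ i : (H.deleteVerts {u, v}).Component, ∃ g,
        IsEvenSelection H.ends (H.edgesMeeting (H.compVerts i)) (H.compVerts i) g ∧
        (Odd (selDegree (H.edgesMeeting (H.compVerts i)) g u) ↔ i ∈ J) ∧
        (Odd (selDegree (H.edgesMeeting (H.compVerts i)) g v) ↔ i ∈ J) := by
      intro i
      by_cases hi : i ∈ J
      · obtain ⟨-, g, hg, h1, h2⟩ := (sComponent_iff hne huv hodd i).1 (hin i hi)
        exact ⟨g, hg, iff_of_true h1 hi, iff_of_true h2 hi⟩
      · obtain ⟨g, hg, h1, h2⟩ := (hout i hi).elim (exists_of_componentGraph i)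
          fun h => ((sStarComponent_iff hne huv hodd i).1 h).2
        exact ⟨g, hg, iff_of_false (Nat.not_odd_iff_even.2 h1) hi,
          iff_of_false (Nat.not_odd_iff_even.2 h2) hi⟩
    choose g hg hgu hgv using hex
    -- At most one `i` contributes to each edge. Copies of `S` get the empty set, which is harmless
    -- because only edges meeting components are constrained here.
    let G : E → Set V := fun e =>
      {x | ∃ i, e ∈ H.edgesMeeting (H.compVerts (S := {u, v}) i) ∧ x ∈ g i e}
    have hG : ∀ i, ∀ e ∈ H.edgesMeeting (H.compVerts i), g i e = G e := by
      intro i e he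
      ext x
      refine ⟨fun hx => ⟨i, he, hx⟩, ?_⟩
      rintro ⟨j, hj, hx⟩
      rwa [eq_of_mem_edgesMeeting he hj]
    refine ⟨hsub, G, fun i => (hg i).congr (hG i), ?_, ?_⟩
    · simp only [← fun i => selDegree_congr (hG i), hgu]
      exact hJ
    · simp only [← fun i => selDegree_congr (hG i), hgv]
      exact hJ
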